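/- For integers $n\ge 0$ and $0\le k<2^n$ call $I=[k2^{-n},(k+1)2^{-n})$ a dyadic subinterval of $[0,1)$; let $I_-$ and $I_+$ be its left and right halves, and $h_I=|I|^{-1/2}(\chi_{I_+}-\chi_{I_-})$. For a weight $w$ on $[0,1)$ (an integrable, almost everywhere positive function) let $M^dw(x)=\sup_{I\ni x}\frac1{|I|}\int_I w$, the supremum over dyadic subintervals of $[0,1)$, and let $[w]_{A_1^d}$ be the least $C\in[0,\infty]$ such that $M^dw\le C\,w$ almost everywhere on $[0,1)$; write $w\in A_1^d$ if $[w]_{A_1^d}<\infty$. For an operator $T$ let $\|T:L^1(w)\to L^{1,\infty}(w)\|$ be the least $C\in[0,\infty]$ such that $$\alpha\, w\{x\in[0,1): |Tf(x)|>\alpha\}\le C\int_0^1|f|\,w\,dx\qquad\text{for all } f\in L^1(w),\ \alpha>0,$$ where $w(E)=\int_E w\,dx$. **Theorem.** There are an absolute constant $c>0$, a sequence of weights $w_n\in A_1^d$ on $[0,1)$ with $[w_n]_{A_1^d}\to\infty$, and dyadic martingale transforms $$T_nf=\sum_I \varepsilon^{(n)}_I\,(f,h_I)\,h_I,\qquad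 (f,h_I)=\int_0^1 f\,h_I\,dx,\qquad \varepsilon_I^{(n)}\in\{0,-1\},$$ with only finitely many $\varepsilon_I^{(n)}$ non-zero for each $n$, such that for every $n$ $$\|T_n:L^1(w_n)\to L^{1,\infty}(w_n)\|\ \ge\ c\,[w_n]_{A_1^d}\,\log [w_n]_{A_1^d}.$$ -/

import Mathlib

open MeasureTheory Set Filter
open scoped ENNReal Topology

noncomputable section

/-- Indices of the dyadic subintervals of `[0,1)`: the pair `⟨n, k⟩` with `k < 2 ^ n`. -/
abbrev DyadicIndex : Type := (n : ℕ) × Fin (2 ^ n)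

namespace DyadicIndex

/-- Left endpoint `k / 2 ^ n`. -/
def left (I : DyadicIndex) : ℝ := (I.2 : ℕ) / 2 ^ I.1

/-- Length `|I| = 1 / 2 ^ n`. -/
def length (I : DyadicIndex) : ℝ := 1 / 2 ^ I.1

/-- The dyadic interval `[k / 2 ^ n, (k + 1) / 2 ^ n)`. -/
def toSet (I : DyadicIndex) : Set ℝ := Ico I.left (I.left + I.length)

/-- The left child of `I`. -/
def leftHalf (I : DyadicIndex) : Set ℝ := Ico I.left (I.left + I.length / 2)

/-- The right child of `I`. -/
def rightHalf (I : DyadicIndex) : Set ℝ := Ico (I.left + I.length / 2) (I.left + I.length)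

/-- The `L²`-normalized Haar function `|I|^{-1/2} (χ_{I₊} - χ_{I₋})`. -/
def haar (I : DyadicIndex) (x : ℝ) : ℝ :=
  (Real.sqrt I.length)⁻¹ *
    (I.rightHalf.indicator (fun _ => (1 : ℝ)) x - I.leftHalf.indicator (fun _ => (1 : ℝ)) x)

end DyadicIndex

/-- Lebesgue measure on `[0,1)`. -/
def unitMeasure : Measure ℝ := volume.restrict (Ico 0 1)

/-- A weight on `[0,1)`: an integrable function that is positive almost everywhere. -/
def IsWeight (w : ℝ → ℝ) : Prop :=
  Integrable w unitMeasure ∧ ∀ᵐ x ∂unitMeasure, 0 < w x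

/-- The measure `w dx` on `[0,1)`. -/
def weightMeasure (w : ℝ → ℝ) : Measure ℝ :=
  unitMeasure.withDensity fun x => ENNReal.ofReal (w x)

/-- The dyadic maximal function `M^d f (x) = sup_{I ∋ x} ⟨|f|⟩_I`, where `I` runs over the dyadic
subintervals of `[0,1)`. -/
def dyadicMaximal (f : ℝ → ℝ) (x : ℝ) : ℝ≥0∞ :=
  ⨆ (I : DyadicIndex) (_ : x ∈ I.toSet), ⨍⁻ y in I.toSet, ‖f y‖ₑ ∂volume

/-- The dyadic `A₁` characteristic `[w]_{A₁^d}`: the least `C` such that `M^d w ≤ C w` almost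
everywhere on `[0,1)` (`∞` if there is no finite one). -/
def dyadicA1Const (w : ℝ → ℝ) : ℝ≥0∞ :=
  sInf {C : ℝ≥0∞ | ∀ᵐ x ∂unitMeasure, dyadicMaximal w x ≤ C * ENNReal.ofReal (w x)}

/-- `w ∈ A₁^d`. -/
def IsDyadicA1 (w : ℝ → ℝ) : Prop :=
  IsWeight w ∧ dyadicA1Const w < ∞

/-- The dyadic martingale transform `T f = ∑_I ε_I (f, h_I) h_I`, for a symbol `ε` with finitely
many non-zero entries. -/
def martingaleTransform (ε : DyadicIndex →₀ ℝ) (f : ℝ → ℝ) (x : ℝ) : ℝ :=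
  ε.sum fun I e => e * (∫ y, f y * I.haar y ∂unitMeasure) * I.haar x

/-- The norm of `T : L¹(w) → L^{1,∞}(w)`: the least `C` such that
`α w{|T f| > α} ≤ C ‖f‖_{L¹(w)}` for all `f ∈ L¹(w)` and all `α > 0`. (For `w ∈ A₁^d` the weight is
bounded below by a positive constant, so `L¹(w) ⊆ L¹(dx)`.) -/
def weakNorm (T : (ℝ → ℝ) → ℝ → ℝ) (w : ℝ → ℝ) : ℝ≥0∞ :=
  sInf {C : ℝ≥0∞ | ∀ f : ℝ → ℝ, Integrable f (weightMeasure w) → ∀ α : ℝ, 0 < α →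
    ENNReal.ofReal α * weightMeasure w {x | α < |T f x|} ≤ C * ∫⁻ x, ‖f x‖ₑ ∂weightMeasure w}

end

/-! Put `Q = 4 ^ N`. The example is a random walk driven by the probability measure `w / Q`, with `T
f` as its position. In one attempt, a portion of about 3/4 of the weighted mass moves up by `u - 1`
and continues with a rescaled copy of the previous tree. A portion of about 1/4 moves down by the
same amount and tries again on a quarter of the interval, with `f` about four times larger. Chances
shrink by 4 while jumps grow by about 4, so each of the `N` attempts of a cycle adds about 1/2 to
the mean position, a cycle adds about `N / 2`, and this is where the logarithm comes from.

After `N` failures `f` is dropped: it lives where `w` is least and vanishes where `w` is heavy. A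
cycle therefore costs at most 3 in `∫ f w` (`cost_cycles_succ_le`) and loses only a fraction of
order `1 / Q` of the weighted mass, so `Q` cycles can be run. Then `∫ f w` is at most of order `Q`,
while `∫ (T f) w` is at least of order `N Q ^ 2` (`le_moment₁_cycles`) and `∫ (T f) ^ 2 w` at most
of order `N ^ 2 Q ^ 3` (`moment₂_cycles_le`).

A Paley–Zygmund argument (`IsA1.le_weightMeasure_transform`) gives `T f > N Q / 20` on a set of
weighted mass at least a constant times `Q`, so the weak norm is at least of order `N Q`, that is `Q
log Q`. Since every tree has mean weight `Q` and minimum 1, its `A₁` constant is exactly `Q`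
(`IsA1.dyadicA1Const_eq`). -/

noncomputable section

/-- Finite binary trees describing a pair `(f, w)` of dyadic step functions together with a
`{0, -1}`-valued symbol; the flag of a node says whether its Haar coefficient is active. -/
inductive HaarTree : Type
  | leaf (f w : ℝ) : HaarTree
  | node (e : Bool) (l r : HaarTree) : HaarTree

/-! ### Self-similarity of Lebesgue measure on the unit interval -/

instance : IsFiniteMeasure unitMeasure := by
  unfold unitMeasure; infer_instance

/-- This is what turns an integral over a node into the average of integrals over its two children,
the step of all inductions on trees. -/
theorem unitMeasure_eq_add_map :
    unitMeasure = (2⁻¹ : ℝ≥0∞) • unitMeasure.map (fun y : ℝ => 2⁻¹ * y) +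
      (2⁻¹ : ℝ≥0∞) • unitMeasure.map (fun y : ℝ => 2⁻¹ * y + 2⁻¹) := by
  have e0 : MeasurableEmbedding (fun y : ℝ => 2⁻¹ * y) :=
    measurableEmbedding_mulLeft₀ (by norm_num)
  have e1 : MeasurableEmbedding (fun y : ℝ => 2⁻¹ * y + 2⁻¹) :=
    (measurableEmbedding_addRight (2⁻¹ : ℝ)).comp e0
  have v0 : (volume : Measure ℝ).map (fun y : ℝ => 2⁻¹ * y) = (2 : ℝ≥0∞) • volume := by
    have := Real.map_volume_mul_left (a := 2⁻¹) (by norm_num)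
    rw [this]; norm_num
  have v1 : (volume : Measure ℝ).map (fun y : ℝ => 2⁻¹ * y + 2⁻¹) = (2 : ℝ≥0∞) • volume := by
    have : (fun y : ℝ => 2⁻¹ * y + 2⁻¹) = (fun y : ℝ => y + 2⁻¹) ∘ (fun y : ℝ => 2⁻¹ * y) := rfl
    rw [this, ← Measure.map_map (by fun_prop) (by fun_prop), v0, Measure.map_smul,
      map_add_right_eq_self]
  have h0 := e0.restrict_map volume (Ico 0 2⁻¹)
  have h1 := e1.restrict_map volume (Ico 2⁻¹ 1)
  have p0 : (fun y : ℝ => 2⁻¹ * y) ⁻¹' (Ico 0 2⁻¹) = Ico 0 1 := by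
    ext y; simp only [mem_preimage, mem_Ico]; constructor <;> rintro ⟨a, b⟩ <;>
      constructor <;> linarith
  have p1 : (fun y : ℝ => 2⁻¹ * y + 2⁻¹) ⁻¹' (Ico 2⁻¹ 1) = Ico 0 1 := by
    ext y; simp only [mem_preimage, mem_Ico]; constructor <;> rintro ⟨a, b⟩ <;>
      constructor <;> linarith
  rw [v0, p0] at h0
  rw [v1, p1] at h1
  unfold unitMeasure
  rw [← h0, ← h1, Measure.restrict_smul, Measure.restrict_smul, smul_smul, smul_smul,
    ENNReal.inv_mul_cancel (by norm_num) (by norm_num), one_smul, one_smul,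
    ← Measure.restrict_union _ measurableSet_Ico, Ico_union_Ico_eq_Ico (by norm_num) (by norm_num)]
  rw [Set.disjoint_left]; rintro x ⟨_, h⟩ ⟨h', _⟩; linarith

theorem ae_unitMeasure_mem : ∀ᵐ x ∂unitMeasure, x ∈ Ico (0 : ℝ) 1 :=
  ae_restrict_mem measurableSet_Ico

theorem lintegral_unitMeasure_split (F : ℝ → ℝ≥0∞) :
    ∫⁻ x, F x ∂unitMeasure = 2⁻¹ * ∫⁻ x, F (2⁻¹ * x) ∂unitMeasure +
      2⁻¹ * ∫⁻ x, F (2⁻¹ * x + 2⁻¹) ∂unitMeasure := by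
  have e0 : MeasurableEmbedding (fun y : ℝ => 2⁻¹ * y) :=
    measurableEmbedding_mulLeft₀ (by norm_num)
  have e1 : MeasurableEmbedding (fun y : ℝ => 2⁻¹ * y + 2⁻¹) :=
    (measurableEmbedding_addRight (2⁻¹ : ℝ)).comp e0
  conv_lhs => rw [unitMeasure_eq_add_map]
  rw [lintegral_add_measure, lintegral_smul_measure, lintegral_smul_measure, e0.lintegral_map,
    e1.lintegral_map, smul_eq_mul, smul_eq_mul]

theorem integral_unitMeasure_split {F : ℝ → ℝ} (hF : Integrable F unitMeasure) :
    ∫ x, F x ∂unitMeasure = 2⁻¹ * ∫ x, F (2⁻¹ * x) ∂unitMeasure +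
      2⁻¹ * ∫ x, F (2⁻¹ * x + 2⁻¹) ∂unitMeasure := by
  have e0 : MeasurableEmbedding (fun y : ℝ => 2⁻¹ * y) :=
    measurableEmbedding_mulLeft₀ (by norm_num)
  have e1 : MeasurableEmbedding (fun y : ℝ => 2⁻¹ * y + 2⁻¹) :=
    (measurableEmbedding_addRight (2⁻¹ : ℝ)).comp e0
  have hF' := hF
  rw [unitMeasure_eq_add_map, integrable_add_measure] at hF'
  conv_lhs => rw [unitMeasure_eq_add_map]
  rw [integral_add_measure hF'.1 hF'.2, integral_smul_measure, integral_smul_measure,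
    e0.integral_map, e1.integral_map]
  simp

/-! ### Haar functions under dyadic dilation -/

/-- The `L²`-normalized Haar function of `[k / 2 ^ n, (k + 1) / 2 ^ n)`. -/
def haarAt (n k : ℕ) (x : ℝ) : ℝ :=
  (Real.sqrt (1 / 2 ^ n))⁻¹ *
    ((Ico ((k : ℝ) / 2 ^ n + 1 / 2 ^ n / 2) ((k : ℝ) / 2 ^ n + 1 / 2 ^ n)).indicator
        (fun _ => (1 : ℝ)) x -
      (Ico ((k : ℝ) / 2 ^ n) ((k : ℝ) / 2 ^ n + 1 / 2 ^ n / 2)).indicator (fun _ => (1 : ℝ)) x)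

theorem indicator_Ico_eq_of_iff {a b a' b' x x' : ℝ} (h1 : a ≤ x ↔ a' ≤ x')
    (h2 : x < b ↔ x' < b') :
    (Ico a b).indicator (fun _ => (1 : ℝ)) x = (Ico a' b').indicator (fun _ => (1 : ℝ)) x' := by
  simp only [indicator_apply, mem_Ico, h1, h2]

theorem inv_sqrt_inv_two_pow_succ (n : ℕ) :
    (Real.sqrt (1 / 2 ^ (n + 1)))⁻¹ = Real.sqrt 2 * (Real.sqrt (1 / 2 ^ n))⁻¹ := by
  rw [← Real.sqrt_inv, ← Real.sqrt_inv, ← Real.sqrt_mul (by norm_num)]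
  congr 1; simp [pow_succ, mul_comm]

theorem haarAt_succ_left (n k : ℕ) (x : ℝ) :
    haarAt (n + 1) k x = Real.sqrt 2 * haarAt n k (2 * x) := by
  unfold haarAt
  rw [inv_sqrt_inv_two_pow_succ, mul_assoc]
  have hp : (k : ℝ) / 2 ^ (n + 1) = (k : ℝ) / 2 ^ n / 2 := by rw [pow_succ]; field_simp
  have hq : (1 : ℝ) / 2 ^ (n + 1) = 1 / 2 ^ n / 2 := by rw [pow_succ]; field_simp
  rw [hp, hq]
  congr 3 <;> apply indicator_Ico_eq_of_iff <;> constructor <;> intro h <;> linarith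

theorem haarAt_succ_right (n k : ℕ) (x : ℝ) :
    haarAt (n + 1) (2 ^ n + k) x = Real.sqrt 2 * haarAt n k (2 * x - 1) := by
  unfold haarAt
  rw [inv_sqrt_inv_two_pow_succ, mul_assoc]
  have hp : ((2 ^ n + k : ℕ) : ℝ) / 2 ^ (n + 1) = 1 / 2 + (k : ℝ) / 2 ^ n / 2 := by
    rw [pow_succ]; push_cast; field_simp
  have hq : (1 : ℝ) / 2 ^ (n + 1) = 1 / 2 ^ n / 2 := by rw [pow_succ]; field_simp
  rw [hp, hq]
  congr 3 <;> apply indicator_Ico_eq_of_iff <;> constructor <;> intro h <;> linarith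

theorem haarAt_eq_zero {n k : ℕ} (hk : k < 2 ^ n) {x : ℝ} (hx : x < 0 ∨ 1 ≤ x) :
    haarAt n k x = 0 := by
  have h0 : (0 : ℝ) ≤ (k : ℝ) / 2 ^ n := by positivity
  have h1 : (k : ℝ) / 2 ^ n + 1 / 2 ^ n ≤ 1 := by
    rw [← add_div, div_le_one (by positivity)]; exact_mod_cast hk
  have h2 : (0 : ℝ) < 1 / 2 ^ n := by positivity
  unfold haarAt
  rw [indicator_of_notMem, indicator_of_notMem, sub_self, mul_zero] <;> rintro ⟨a, b⟩ <;>
    rcases hx with hx | hx <;> linarith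

theorem haarAt_zero_of_lt {x : ℝ} (h0 : 0 ≤ x) (h : x < 2⁻¹) : haarAt 0 0 x = -1 := by
  unfold haarAt
  rw [indicator_of_notMem, indicator_of_mem]
  · simp
  · simp; exact ⟨h0, by linarith⟩
  · simp; intro; linarith

theorem haarAt_zero_of_le {x : ℝ} (h0 : 2⁻¹ ≤ x) (h : x < 1) : haarAt 0 0 x = 1 := by
  unfold haarAt
  rw [indicator_of_mem, indicator_of_notMem]
  · simp
  · simp; intro; linarith
  · simp; exact ⟨by linarith, h⟩

theorem measurable_haarAt (n k : ℕ) : Measurable (haarAt n k) := by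
  unfold haarAt
  exact ((measurable_const.indicator measurableSet_Ico).sub
    (measurable_const.indicator measurableSet_Ico)).const_mul _

theorem abs_haarAt_le (n k : ℕ) (x : ℝ) : |haarAt n k x| ≤ (Real.sqrt (1 / 2 ^ n))⁻¹ := by
  unfold haarAt
  rw [abs_mul, abs_of_nonneg (by positivity : (0 : ℝ) ≤ (Real.sqrt (1 / 2 ^ n))⁻¹)]
  refine mul_le_of_le_one_right (by positivity) ?_
  simp only [indicator_apply]
  split_ifs <;> norm_num

/-! ### Step functions on trees and their martingale transforms -/

namespace HaarTree

/-- The coefficient `0` or `-1` of a node with flag `e`. -/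
def coef (e : Bool) : ℝ := bif e then -1 else 0

/-- The step function `f` of the tree. -/
def fn : HaarTree → ℝ → ℝ
  | leaf f _, _ => f
  | node _ l r, x => if x < 2⁻¹ then l.fn (2 * x) else r.fn (2 * x - 1)

/-- The weight `w` of the tree. -/
def wt : HaarTree → ℝ → ℝ
  | leaf _ w, _ => w
  | node _ l r, x => if x < 2⁻¹ then l.wt (2 * x) else r.wt (2 * x - 1)

/-- The mean of `f`. -/
def meanF : HaarTree → ℝ
  | leaf f _ => f
  | node _ l r => (l.meanF + r.meanF) / 2

/-- The mean of `w`. -/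
def meanW : HaarTree → ℝ
  | leaf _ w => w
  | node _ l r => (l.meanW + r.meanW) / 2

/-- The martingale transform of `f` with the symbol of the tree. -/
def transf : HaarTree → ℝ → ℝ
  | leaf _ _, _ => 0
  | node e l r, x =>
    if x < 2⁻¹ then coef e * ((l.meanF - r.meanF) / 2) + l.transf (2 * x)
    else coef e * ((r.meanF - l.meanF) / 2) + r.transf (2 * x - 1)

/-- The height of the tree. -/
def depth : HaarTree → ℕ
  | leaf _ _ => 0
  | node _ l r => max l.depth r.depth + 1

/-- The symbol of the tree at the dyadic interval `[k / 2 ^ n, (k + 1) / 2 ^ n)`. -/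
def symbolAt : HaarTree → ℕ → ℕ → ℝ
  | leaf _ _, _, _ => 0
  | node e _ _, 0, _ => coef e
  | node _ l r, n + 1, k => if k < 2 ^ n then l.symbolAt n k else r.symbolAt n (k - 2 ^ n)

theorem symbolAt_eq_zero_or (t : HaarTree) (n k : ℕ) :
    t.symbolAt n k = 0 ∨ t.symbolAt n k = -1 := by
  induction t generalizing n k with
  | leaf f w => exact Or.inl rfl
  | node e l r hl hr =>
    cases n with
    | zero => cases e <;> simp [symbolAt, coef]
    | succ n => simp only [symbolAt]; split_ifs; exacts [hl _ _, hr _ _]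

theorem symbolAt_eq_zero (t : HaarTree) {n : ℕ} (hn : t.depth ≤ n) (k : ℕ) :
    t.symbolAt n k = 0 := by
  induction t generalizing n k with
  | leaf f w => rfl
  | node e l r hl hr =>
    cases n with
    | zero => simp [depth] at hn
    | succ n =>
      simp only [depth, Nat.add_le_add_iff_right, max_le_iff] at hn
      simp only [symbolAt]; split_ifs; exacts [hl hn.1 _, hr hn.2 _]

/-- The symbol of the tree. -/
def symbol (t : HaarTree) : DyadicIndex →₀ ℝ :=
  Finsupp.onFinset ((Finset.range t.depth).sigma fun _ => Finset.univ)
    (fun I => t.symbolAt I.1 I.2) (by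
      intro I hI
      simp only [Finset.mem_sigma, Finset.mem_range, Finset.mem_univ, and_true]
      by_contra h
      exact hI (t.symbolAt_eq_zero (not_lt.mp h) _))

theorem martingaleTransform_symbol (t : HaarTree) (f : ℝ → ℝ) (x : ℝ) :
    martingaleTransform t.symbol f x = ∑ n ∈ Finset.range t.depth, ∑ k ∈ Finset.range (2 ^ n),
      t.symbolAt n k * (∫ y, f y * haarAt n k y ∂unitMeasure) * haarAt n k x := by
  unfold martingaleTransform symbol
  rw [Finsupp.sum_of_support_subset _ Finsupp.support_onFinset_subset _ (by simp),
    Finset.sum_sigma]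
  refine Finset.sum_congr rfl fun n _ => ?_
  rw [← Fin.sum_univ_eq_sum_range (fun k => t.symbolAt n k *
    (∫ y, f y * haarAt n k y ∂unitMeasure) * haarAt n k x)]
  rfl

theorem measurable_fn (t : HaarTree) : Measurable t.fn := by
  induction t with
  | leaf f w => exact measurable_const
  | node e l r hl hr =>
    exact Measurable.ite measurableSet_Iio (hl.comp (by fun_prop)) (hr.comp (by fun_prop))

theorem measurable_wt (t : HaarTree) : Measurable t.wt := by
  induction t with
  | leaf f w => exact measurable_const
  | node e l r hl hr =>
    exact Measurable.ite measurableSet_Iio (hl.comp (by fun_prop)) (hr.comp (by fun_prop))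

theorem measurable_transf (t : HaarTree) : Measurable t.transf := by
  induction t with
  | leaf f w => exact measurable_const
  | node e l r hl hr =>
    exact Measurable.ite measurableSet_Iio ((hl.comp (by fun_prop)).const_add _)
      ((hr.comp (by fun_prop)).const_add _)

theorem exists_abs_fn_le (t : HaarTree) : ∃ B, ∀ x, |t.fn x| ≤ B := by
  induction t with
  | leaf f w => exact ⟨|f|, fun _ => le_rfl⟩
  | node e l r hl hr =>
    obtain ⟨B, hB⟩ := hl
    obtain ⟨B', hB'⟩ := hr
    refine ⟨max B B', fun x => ?_⟩
    simp only [fn]; split_ifs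
    exacts [(hB _).trans (le_max_left _ _), (hB' _).trans (le_max_right _ _)]

theorem exists_abs_wt_le (t : HaarTree) : ∃ B, ∀ x, |t.wt x| ≤ B := by
  induction t with
  | leaf f w => exact ⟨|w|, fun _ => le_rfl⟩
  | node e l r hl hr =>
    obtain ⟨B, hB⟩ := hl
    obtain ⟨B', hB'⟩ := hr
    refine ⟨max B B', fun x => ?_⟩
    simp only [wt]; split_ifs
    exacts [(hB _).trans (le_max_left _ _), (hB' _).trans (le_max_right _ _)]

theorem integrable_fn (t : HaarTree) : Integrable t.fn unitMeasure := by
  obtain ⟨B, hB⟩ := t.exists_abs_fn_le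
  exact Integrable.of_bound t.measurable_fn.aestronglyMeasurable B (ae_of_all _ hB)

theorem integrable_wt (t : HaarTree) : Integrable t.wt unitMeasure := by
  obtain ⟨B, hB⟩ := t.exists_abs_wt_le
  exact Integrable.of_bound t.measurable_wt.aestronglyMeasurable B (ae_of_all _ hB)

theorem integrable_fn_mul_haarAt (t : HaarTree) (n k : ℕ) :
    Integrable (fun x => t.fn x * haarAt n k x) unitMeasure := by
  obtain ⟨B, hB⟩ := t.exists_abs_fn_le
  refine Integrable.of_bound (t.measurable_fn.mul (measurable_haarAt n k)).aestronglyMeasurable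
    (B * (Real.sqrt (1 / 2 ^ n))⁻¹) (ae_of_all _ fun x => ?_)
  rw [Real.norm_eq_abs, abs_mul]
  exact mul_le_mul (hB x) (abs_haarAt_le n k x) (abs_nonneg _) ((abs_nonneg _).trans (hB x))

theorem integral_fn (t : HaarTree) : ∫ x, t.fn x ∂unitMeasure = t.meanF := by
  induction t with
  | leaf f w => simp [fn, meanF, unitMeasure]
  | node e l r hl hr =>
    rw [integral_unitMeasure_split (integrable_fn _)]
    have h0 : ∫ x, (node e l r).fn (2⁻¹ * x) ∂unitMeasure = l.meanF := by
      rw [← hl]; refine integral_congr_ae ?_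
      filter_upwards [ae_unitMeasure_mem] with x hx
      simp only [fn]; rw [if_pos (by linarith [hx.2])]; congr 1; ring
    have h1 : ∫ x, (node e l r).fn (2⁻¹ * x + 2⁻¹) ∂unitMeasure = r.meanF := by
      rw [← hr]; refine integral_congr_ae ?_
      filter_upwards [ae_unitMeasure_mem] with x hx
      simp only [fn]; rw [if_neg (by linarith [hx.1])]; congr 1; ring
    rw [h0, h1, meanF]; ring

theorem integral_node_haarAt_zero (e : Bool) (l r : HaarTree) :
    ∫ y, (node e l r).fn y * haarAt 0 0 y ∂unitMeasure = (r.meanF - l.meanF) / 2 := by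
  rw [integral_unitMeasure_split (integrable_fn_mul_haarAt _ _ _)]
  have h0 : ∫ x, (node e l r).fn (2⁻¹ * x) * haarAt 0 0 (2⁻¹ * x) ∂unitMeasure = -l.meanF := by
    rw [← integral_fn, ← integral_neg]; refine integral_congr_ae ?_
    filter_upwards [ae_unitMeasure_mem] with x hx
    rw [haarAt_zero_of_lt (by linarith [hx.1]) (by linarith [hx.2])]
    simp only [fn]; rw [if_pos (by linarith [hx.2]), mul_neg_one]; congr 2; ring
  have h1 : ∫ x, (node e l r).fn (2⁻¹ * x + 2⁻¹) * haarAt 0 0 (2⁻¹ * x + 2⁻¹) ∂unitMeasure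
      = r.meanF := by
    rw [← integral_fn]; refine integral_congr_ae ?_
    filter_upwards [ae_unitMeasure_mem] with x hx
    rw [haarAt_zero_of_le (by linarith [hx.1]) (by linarith [hx.2])]
    simp only [fn]; rw [if_neg (by linarith [hx.1]), mul_one]; congr 1; ring
  rw [h0, h1]; ring

theorem integral_node_haarAt_left (e : Bool) (l r : HaarTree) {n k : ℕ} (hk : k < 2 ^ n) :
    ∫ y, (node e l r).fn y * haarAt (n + 1) k y ∂unitMeasure =
      Real.sqrt 2 / 2 * ∫ y, l.fn y * haarAt n k y ∂unitMeasure := by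
  rw [integral_unitMeasure_split (integrable_fn_mul_haarAt _ _ _)]
  have h0 : ∫ x, (node e l r).fn (2⁻¹ * x) * haarAt (n + 1) k (2⁻¹ * x) ∂unitMeasure =
      Real.sqrt 2 * ∫ y, l.fn y * haarAt n k y ∂unitMeasure := by
    rw [← integral_const_mul]; refine integral_congr_ae ?_
    filter_upwards [ae_unitMeasure_mem] with x hx
    have : 2 * (2⁻¹ * x) = x := by ring
    simp only [fn]; rw [if_pos (by linarith [hx.2]), haarAt_succ_left, this]; ring
  have h1 : ∫ x, (node e l r).fn (2⁻¹ * x + 2⁻¹) * haarAt (n + 1) k (2⁻¹ * x + 2⁻¹) ∂unitMeasure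
      = 0 := by
    refine integral_eq_zero_of_ae ?_
    filter_upwards [ae_unitMeasure_mem] with x hx
    rw [haarAt_succ_left, haarAt_eq_zero hk (Or.inr (by linarith [hx.1]))]; simp
  rw [h0, h1]; ring

theorem integral_node_haarAt_right (e : Bool) (l r : HaarTree) {n k : ℕ} (hk : k < 2 ^ n) :
    ∫ y, (node e l r).fn y * haarAt (n + 1) (2 ^ n + k) y ∂unitMeasure =
      Real.sqrt 2 / 2 * ∫ y, r.fn y * haarAt n k y ∂unitMeasure := by
  rw [integral_unitMeasure_split (integrable_fn_mul_haarAt _ _ _)]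
  have h0 : ∫ x, (node e l r).fn (2⁻¹ * x + 2⁻¹) * haarAt (n + 1) (2 ^ n + k) (2⁻¹ * x + 2⁻¹)
      ∂unitMeasure = Real.sqrt 2 * ∫ y, r.fn y * haarAt n k y ∂unitMeasure := by
    rw [← integral_const_mul]; refine integral_congr_ae ?_
    filter_upwards [ae_unitMeasure_mem] with x hx
    have : 2 * (2⁻¹ * x + 2⁻¹) - 1 = x := by ring
    simp only [fn]; rw [if_neg (by linarith [hx.1]), haarAt_succ_right, this]; ring
  have h1 : ∫ x, (node e l r).fn (2⁻¹ * x) * haarAt (n + 1) (2 ^ n + k) (2⁻¹ * x) ∂unitMeasure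
      = 0 := by
    refine integral_eq_zero_of_ae ?_
    filter_upwards [ae_unitMeasure_mem] with x hx
    rw [haarAt_succ_right, haarAt_eq_zero hk (Or.inl (by linarith [hx.2]))]; simp
  rw [h0, h1]; ring

/-- Level 0 gives the jump at the root, and each level `n + 1` splits into level `n` of the two
subtrees. The bound `d` is kept free because the subtrees may differ in depth. -/
theorem sum_haarAt_eq_transf (t : HaarTree) {d : ℕ} (hd : t.depth ≤ d) {x : ℝ}
    (hx : x ∈ Ico (0 : ℝ) 1) :
    ∑ n ∈ Finset.range d, ∑ k ∈ Finset.range (2 ^ n),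
      t.symbolAt n k * (∫ y, t.fn y * haarAt n k y ∂unitMeasure) * haarAt n k x = t.transf x := by
  induction t generalizing d x with
  | leaf f w => simp [symbolAt, transf]
  | node e l r hl hr =>
    cases d with
    | zero => simp [depth] at hd
    | succ d =>
      simp only [depth, Nat.add_le_add_iff_right, max_le_iff] at hd
      have key : ∀ n ∈ Finset.range d, ∑ k ∈ Finset.range (2 ^ (n + 1)),
          (node e l r).symbolAt (n + 1) k *
            (∫ y, (node e l r).fn y * haarAt (n + 1) k y ∂unitMeasure) * haarAt (n + 1) k x =
          (∑ k ∈ Finset.range (2 ^ n), l.symbolAt n k *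
            (∫ y, l.fn y * haarAt n k y ∂unitMeasure) * haarAt n k (2 * x)) +
          ∑ k ∈ Finset.range (2 ^ n), r.symbolAt n k *
            (∫ y, r.fn y * haarAt n k y ∂unitMeasure) * haarAt n k (2 * x - 1) := by
        intro n _
        rw [pow_succ, mul_two, Finset.sum_range_add]
        -- Passing to a child costs `√2 / 2` in the coefficient and `√2` in the Haar function; the
        -- product is 1.
        have s2 : Real.sqrt 2 * Real.sqrt 2 = 2 := Real.mul_self_sqrt (by norm_num)
        congr 1 <;> refine Finset.sum_congr rfl fun k hk => ?_ <;> rw [Finset.mem_range] at hk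
        · rw [integral_node_haarAt_left e l r hk, haarAt_succ_left]
          simp only [symbolAt, if_pos hk]
          linear_combination (l.symbolAt n k * (∫ y, l.fn y * haarAt n k y ∂unitMeasure) *
            haarAt n k (2 * x) / 2) * s2
        · rw [integral_node_haarAt_right e l r hk, haarAt_succ_right]
          have : ¬ (2 ^ n + k < 2 ^ n) := by omega
          simp only [symbolAt, if_neg this, Nat.add_sub_cancel_left]
          linear_combination (r.symbolAt n k * (∫ y, r.fn y * haarAt n k y ∂unitMeasure) *
            haarAt n k (2 * x - 1) / 2) * s2
      rw [Finset.sum_range_succ', Finset.sum_congr rfl key, Finset.sum_add_distrib]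
      have h0 : ∑ k ∈ Finset.range (2 ^ 0), (node e l r).symbolAt 0 k *
          (∫ y, (node e l r).fn y * haarAt 0 k y ∂unitMeasure) * haarAt 0 k x =
          coef e * ((r.meanF - l.meanF) / 2) * haarAt 0 0 x := by
        simp only [pow_zero, Finset.sum_range_one, integral_node_haarAt_zero, symbolAt]
      rw [h0]
      by_cases h : x < 2⁻¹
      · have hz : ∑ n ∈ Finset.range d, ∑ k ∈ Finset.range (2 ^ n), r.symbolAt n k *
            (∫ y, r.fn y * haarAt n k y ∂unitMeasure) * haarAt n k (2 * x - 1) = 0 := by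
          refine Finset.sum_eq_zero fun n _ => Finset.sum_eq_zero fun k hk => ?_
          rw [haarAt_eq_zero (Finset.mem_range.mp hk) (Or.inl (by linarith)), mul_zero]
        rw [hz, hl hd.1 ⟨by linarith [hx.1], by linarith⟩, haarAt_zero_of_lt hx.1 h]
        simp only [transf, if_pos h]; ring
      · have hz : ∑ n ∈ Finset.range d, ∑ k ∈ Finset.range (2 ^ n), l.symbolAt n k *
            (∫ y, l.fn y * haarAt n k y ∂unitMeasure) * haarAt n k (2 * x) = 0 := by
          refine Finset.sum_eq_zero fun n _ => Finset.sum_eq_zero fun k hk => ?_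
          rw [haarAt_eq_zero (Finset.mem_range.mp hk) (Or.inr (by linarith)), mul_zero]
        rw [hz, hr hd.2 ⟨by linarith, by linarith [hx.2]⟩, haarAt_zero_of_le (by linarith) hx.2]
        simp only [transf, if_neg h]; ring

theorem martingaleTransform_eq_transf (t : HaarTree) {x : ℝ} (hx : x ∈ Ico (0 : ℝ) 1) :
    martingaleTransform t.symbol t.fn x = t.transf x := by
  rw [martingaleTransform_symbol, sum_haarAt_eq_transf t le_rfl hx]


/-! ### Recursive means, costs and moments -/

/-- The least value of `w`. -/
def minW : HaarTree → ℝ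
  | leaf _ w => w
  | node _ l r => min l.minW r.minW

/-- The values of `f` are nonnegative, those of `w` are positive, and all means of `w` over subtrees are at most `Q` times
the least value of `w` there. -/
def IsA1 (Q : ℝ) : HaarTree → Prop
  | leaf f w => 0 ≤ f ∧ 0 < w
  | node e l r => l.IsA1 Q ∧ r.IsA1 Q ∧ (node e l r).meanW ≤ Q * (node e l r).minW

/-- The integral of `Φ (g + T f) f w`. -/
def expect (Φ : ℝ → ℝ → ℝ → ℝ) : HaarTree → ℝ → ℝ
  | leaf f w, g => Φ g f w
  | node e l r, g => (l.expect Φ (g + coef e * ((l.meanF - r.meanF) / 2)) +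
      r.expect Φ (g + coef e * ((r.meanF - l.meanF) / 2))) / 2

/-- The integral of `f w`. -/
def cost : HaarTree → ℝ
  | leaf f w => f * w
  | node _ l r => (l.cost + r.cost) / 2

/-- The integral of `(T f) w`. -/
def moment₁ : HaarTree → ℝ
  | leaf _ _ => 0
  | node e l r => (l.moment₁ + r.moment₁ +
      coef e * ((l.meanF - r.meanF) / 2) * (l.meanW - r.meanW)) / 2

/-- The integral of `(T f) ^ 2 w`. -/
def moment₂ : HaarTree → ℝ
  | leaf _ _ => 0
  | node e l r => (l.moment₂ + r.moment₂ +
      2 * (coef e * ((l.meanF - r.meanF) / 2)) * (l.moment₁ - r.moment₁) +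
      (coef e * ((l.meanF - r.meanF) / 2)) ^ 2 * (l.meanW + r.meanW)) / 2

/-- Multiplication of `w` by a constant. -/
def scaleW (c : ℝ) : HaarTree → HaarTree
  | leaf f w => leaf f (c * w)
  | node e l r => node e (l.scaleW c) (r.scaleW c)

section Scale

variable (c : ℝ) (t : HaarTree)

theorem meanF_scaleW : (t.scaleW c).meanF = t.meanF := by
  induction t with
  | leaf f w => rfl
  | node e l r hl hr => simp only [scaleW, meanF, hl, hr]

theorem meanW_scaleW : (t.scaleW c).meanW = c * t.meanW := by
  induction t with
  | leaf f w => rfl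
  | node e l r hl hr => simp only [scaleW, meanW, hl, hr]; ring

theorem cost_scaleW : (t.scaleW c).cost = c * t.cost := by
  induction t with
  | leaf f w => simp only [scaleW, cost]; ring
  | node e l r hl hr => simp only [scaleW, cost, hl, hr]; ring

theorem moment₁_scaleW : (t.scaleW c).moment₁ = c * t.moment₁ := by
  induction t with
  | leaf f w => simp [scaleW, moment₁]
  | node e l r hl hr =>
    simp only [scaleW, moment₁, hl, hr, meanF_scaleW, meanW_scaleW]; ring

theorem moment₂_scaleW : (t.scaleW c).moment₂ = c * t.moment₂ := by
  induction t with
  | leaf f w => simp [scaleW, moment₂]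
  | node e l r hl hr =>
    simp only [scaleW, moment₂, hl, hr, meanF_scaleW, meanW_scaleW, moment₁_scaleW]; ring

variable {c} {t}

theorem minW_scaleW (hc : 0 ≤ c) : (t.scaleW c).minW = c * t.minW := by
  induction t with
  | leaf f w => rfl
  | node e l r hl hr => simp only [scaleW, minW, hl, hr, mul_min_of_nonneg _ _ hc]

theorem IsA1.scaleW {Q : ℝ} (hc : 0 < c) (h : t.IsA1 Q) : (t.scaleW c).IsA1 Q := by
  induction t with
  | leaf f w => exact ⟨h.1, mul_pos hc h.2⟩
  | node e l r hl hr =>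
    refine ⟨hl h.1, hr h.2.1, ?_⟩
    have := h.2.2
    change ((node e l r).scaleW c).meanW ≤ Q * ((node e l r).scaleW c).minW
    rw [meanW_scaleW, minW_scaleW hc.le]
    nlinarith

end Scale

theorem minW_le_wt (t : HaarTree) (x : ℝ) : t.minW ≤ t.wt x := by
  induction t generalizing x with
  | leaf f w => exact le_rfl
  | node e l r hl hr =>
    simp only [minW, wt]; split_ifs
    exacts [(min_le_left _ _).trans (hl _), (min_le_right _ _).trans (hr _)]

theorem IsA1.minW_pos {Q : ℝ} {t : HaarTree} (h : t.IsA1 Q) : 0 < t.minW := by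
  induction t with
  | leaf f w => exact h.2
  | node e l r hl hr => exact lt_min (hl h.1) (hr h.2.1)

theorem IsA1.wt_pos {Q : ℝ} {t : HaarTree} (h : t.IsA1 Q) (x : ℝ) : 0 < t.wt x :=
  h.minW_pos.trans_le (t.minW_le_wt x)

theorem IsA1.fn_nonneg {Q : ℝ} {t : HaarTree} (h : t.IsA1 Q) (x : ℝ) : 0 ≤ t.fn x := by
  induction t generalizing x with
  | leaf f w => exact h.1
  | node e l r hl hr => simp only [fn]; split_ifs; exacts [hl h.1 _, hr h.2.1 _]

theorem IsA1.expect_mono {Q : ℝ} {t : HaarTree} (h : t.IsA1 Q) {Φ Ψ : ℝ → ℝ → ℝ → ℝ}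
    (hle : ∀ g f w, 0 ≤ f → 0 ≤ w → Φ g f w ≤ Ψ g f w) (g : ℝ) :
    t.expect Φ g ≤ t.expect Ψ g := by
  induction t generalizing g with
  | leaf f w => exact hle _ _ _ h.1 h.2.le
  | node e l r hl hr =>
    simp only [expect]
    have := hl h.1 (g + coef e * ((l.meanF - r.meanF) / 2))
    have := hr h.2.1 (g + coef e * ((r.meanF - l.meanF) / 2))
    linarith

theorem IsA1.expect_nonneg {Q : ℝ} {t : HaarTree} (h : t.IsA1 Q) {Φ : ℝ → ℝ → ℝ → ℝ}
    (hΦ : ∀ g f w, 0 ≤ f → 0 ≤ w → 0 ≤ Φ g f w) (g : ℝ) : 0 ≤ t.expect Φ g := by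
  induction t generalizing g with
  | leaf f w => exact hΦ _ _ _ h.1 h.2.le
  | node e l r hl hr =>
    have := hl h.1 (g + coef e * ((l.meanF - r.meanF) / 2))
    have := hr h.2.1 (g + coef e * ((r.meanF - l.meanF) / 2))
    simp only [expect]; positivity

theorem expect_weight (t : HaarTree) (g : ℝ) : t.expect (fun _ _ w => w) g = t.meanW := by
  induction t generalizing g with
  | leaf f w => rfl
  | node e l r hl hr => simp only [expect, meanW, hl, hr]

theorem expect_cost (t : HaarTree) (g : ℝ) : t.expect (fun _ f w => f * w) g = t.cost := by
  induction t generalizing g with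
  | leaf f w => rfl
  | node e l r hl hr => simp only [expect, cost, hl, hr]

/-- Shifting the starting value `g` at a node mixes the moments of the children exactly as in the
recursions for `moment₁` and `moment₂`, so quadratic functionals close up. -/
theorem expect_quadratic (t : HaarTree) (a b α g : ℝ) :
    t.expect (fun g _ w => (a * (g - α) - b * (g - α) ^ 2) * w) g =
      a * (t.moment₁ + (g - α) * t.meanW) -
        b * (t.moment₂ + 2 * (g - α) * t.moment₁ + (g - α) ^ 2 * t.meanW) := by
  induction t generalizing g with
  | leaf f w => simp only [expect, moment₁, moment₂, meanW]; ring
  | node e l r hl hr => simp only [expect, moment₁, moment₂, meanW, hl, hr]; ring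

/-- The starting value `g` must be arbitrary: it absorbs the jump made at the root before the
induction hypothesis is applied to a child. -/
theorem IsA1.lintegral_eq_expect {Q : ℝ} {t : HaarTree} (h : t.IsA1 Q) {Φ : ℝ → ℝ → ℝ → ℝ}
    (hΦ : ∀ g f w, 0 ≤ f → 0 ≤ w → 0 ≤ Φ g f w) (g : ℝ) :
    ∫⁻ x, ENNReal.ofReal (Φ (g + t.transf x) (t.fn x) (t.wt x)) ∂unitMeasure =
      ENNReal.ofReal (t.expect Φ g) := by
  induction t generalizing g with
  | leaf f w => simp [fn, wt, transf, expect, unitMeasure]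
  | node e l r hl hr =>
    have h0 : ∫⁻ x, ENNReal.ofReal (Φ (g + (node e l r).transf (2⁻¹ * x))
        ((node e l r).fn (2⁻¹ * x)) ((node e l r).wt (2⁻¹ * x))) ∂unitMeasure =
        ENNReal.ofReal (l.expect Φ (g + coef e * ((l.meanF - r.meanF) / 2))) := by
      rw [← hl h.1]; refine lintegral_congr_ae ?_
      filter_upwards [ae_unitMeasure_mem] with x hx
      have h1 : 2⁻¹ * x < 2⁻¹ := by linarith [hx.2]
      have h2 : 2 * (2⁻¹ * x) = x := by ring
      simp only [fn, wt, transf, if_pos h1, h2, add_assoc]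
    have h1 : ∫⁻ x, ENNReal.ofReal (Φ (g + (node e l r).transf (2⁻¹ * x + 2⁻¹))
        ((node e l r).fn (2⁻¹ * x + 2⁻¹)) ((node e l r).wt (2⁻¹ * x + 2⁻¹))) ∂unitMeasure =
        ENNReal.ofReal (r.expect Φ (g + coef e * ((r.meanF - l.meanF) / 2))) := by
      rw [← hr h.2.1]; refine lintegral_congr_ae ?_
      filter_upwards [ae_unitMeasure_mem] with x hx
      have h1 : ¬ (2⁻¹ * x + 2⁻¹ < 2⁻¹) := by linarith [hx.1]
      have h2 : 2 * (2⁻¹ * x + 2⁻¹) - 1 = x := by ring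
      simp only [fn, wt, transf, if_neg h1, h2, add_assoc]
    rw [lintegral_unitMeasure_split, h0, h1, ← mul_add,
      ← ENNReal.ofReal_add (h.1.expect_nonneg hΦ _) (h.2.1.expect_nonneg hΦ _)]
    have : (2⁻¹ : ℝ≥0∞) = ENNReal.ofReal 2⁻¹ := by
      rw [ENNReal.ofReal_inv_of_pos (by norm_num)]; norm_num
    rw [this, ← ENNReal.ofReal_mul (by norm_num), expect, inv_mul_eq_div]

theorem IsA1.lintegral_wt {Q : ℝ} {t : HaarTree} (h : t.IsA1 Q) :
    ∫⁻ x, ENNReal.ofReal (t.wt x) ∂unitMeasure = ENNReal.ofReal t.meanW := by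
  rw [h.lintegral_eq_expect (Φ := fun _ _ w => w) (fun _ _ _ _ hw => hw) 0, expect_weight]

theorem IsA1.meanW_le {Q : ℝ} (hQ : 1 ≤ Q) {t : HaarTree} (h : t.IsA1 Q) :
    t.meanW ≤ Q * t.minW := by
  cases t with
  | leaf f w => exact le_mul_of_one_le_left h.2.le hQ
  | node e l r => exact h.2.2

/-! ### The dyadic maximal function and the `A₁` constant -/

/-- The dyadic interval `[k / 2 ^ n, (k + 1) / 2 ^ n)`. -/
def _root_.dyadicIco (n k : ℕ) : Set ℝ := Ico ((k : ℝ) / 2 ^ n) ((k : ℝ) / 2 ^ n + 1 / 2 ^ n)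

theorem _root_.mem_dyadicIco_succ_left {n k : ℕ} {x : ℝ} :
    x ∈ dyadicIco (n + 1) k ↔ 2 * x ∈ dyadicIco n k := by
  have hp : (k : ℝ) / 2 ^ (n + 1) = (k : ℝ) / 2 ^ n / 2 := by rw [pow_succ]; field_simp
  have hq : (1 : ℝ) / 2 ^ (n + 1) = 1 / 2 ^ n / 2 := by rw [pow_succ]; field_simp
  simp only [dyadicIco, mem_Ico, hp, hq]
  constructor <;> rintro ⟨a, b⟩ <;> constructor <;> linarith

theorem _root_.mem_dyadicIco_succ_right {n k : ℕ} {x : ℝ} :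
    x ∈ dyadicIco (n + 1) (2 ^ n + k) ↔ 2 * x - 1 ∈ dyadicIco n k := by
  have hp : ((2 ^ n + k : ℕ) : ℝ) / 2 ^ (n + 1) = 1 / 2 + (k : ℝ) / 2 ^ n / 2 := by
    rw [pow_succ]; push_cast; field_simp
  have hq : (1 : ℝ) / 2 ^ (n + 1) = 1 / 2 ^ n / 2 := by rw [pow_succ]; field_simp
  simp only [dyadicIco, mem_Ico, hp, hq]
  constructor <;> rintro ⟨a, b⟩ <;> constructor <;> linarith

theorem _root_.dyadicIco_subset {n k : ℕ} (hk : k < 2 ^ n) : dyadicIco n k ⊆ Ico 0 1 := by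
  have h0 : (0 : ℝ) ≤ (k : ℝ) / 2 ^ n := by positivity
  have h1 : (k : ℝ) / 2 ^ n + 1 / 2 ^ n ≤ 1 := by
    rw [← add_div, div_le_one (by positivity)]; exact_mod_cast hk
  exact Ico_subset_Ico h0 h1

theorem _root_.volume_dyadicIco (n k : ℕ) : volume (dyadicIco n k) = (2⁻¹ : ℝ≥0∞) ^ n := by
  rw [dyadicIco, Real.volume_Ico, add_sub_cancel_left, one_div, ← inv_pow,
    ENNReal.ofReal_pow (by norm_num), ENNReal.ofReal_inv_of_pos (by norm_num)]
  norm_num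

/-- A dyadic interval either is the interval of a subtree, where `IsA1` bounds the mean by `Q` times
the minimum, or lies in a leaf, where the weight is constant. -/
theorem IsA1.lintegral_indicator_le {Q : ℝ} (hQ : 1 ≤ Q) {t : HaarTree} (h : t.IsA1 Q) {n k : ℕ}
    (hk : k < 2 ^ n) {x : ℝ} (hx : x ∈ dyadicIco n k) :
    ∫⁻ y, (dyadicIco n k).indicator (fun y => ENNReal.ofReal (t.wt y)) y ∂unitMeasure ≤
      2⁻¹ ^ n * ENNReal.ofReal (Q * t.wt x) := by
  classical
  induction t generalizing n k x with
  | leaf f w =>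
    simp only [wt]
    rw [lintegral_indicator_const (show MeasurableSet (dyadicIco n k) from measurableSet_Ico),
      mul_comm]
    refine mul_le_mul' ?_ (ENNReal.ofReal_le_ofReal (le_mul_of_one_le_left h.2.le hQ))
    exact (Measure.restrict_apply_le _ _).trans (volume_dyadicIco n k).le
  | node e l r hl hr =>
    cases n with
    | zero =>
      rw [pow_zero, one_mul]
      refine (lintegral_mono (indicator_le_self _ _)).trans ?_
      rw [h.lintegral_wt]
      refine ENNReal.ofReal_le_ofReal ((h.meanW_le hQ).trans ?_)
      exact mul_le_mul_of_nonneg_left (minW_le_wt _ _) (by linarith)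
    | succ n =>
      rw [lintegral_unitMeasure_split]
      by_cases hkn : k < 2 ^ n
      · have h0 : ∫⁻ y, (dyadicIco (n + 1) k).indicator
            (fun y => ENNReal.ofReal ((node e l r).wt y)) (2⁻¹ * y) ∂unitMeasure =
            ∫⁻ y, (dyadicIco n k).indicator (fun y => ENNReal.ofReal (l.wt y)) y ∂unitMeasure := by
          refine lintegral_congr_ae ?_
          filter_upwards [ae_unitMeasure_mem] with y hy
          have h1 : 2⁻¹ * y < 2⁻¹ := by linarith [hy.2]
          have h2 : 2 * (2⁻¹ * y) = y := by ring
          simp only [indicator_apply, mem_dyadicIco_succ_left, h2, wt, if_pos h1]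
        have h1 : ∫⁻ y, (dyadicIco (n + 1) k).indicator
            (fun y => ENNReal.ofReal ((node e l r).wt y)) (2⁻¹ * y + 2⁻¹) ∂unitMeasure = 0 := by
          rw [← lintegral_zero (μ := unitMeasure)]
          refine lintegral_congr_ae ?_
          filter_upwards [ae_unitMeasure_mem] with y hy
          rw [indicator_of_notMem]
          rw [mem_dyadicIco_succ_left]
          intro hm
          linarith [(dyadicIco_subset hkn hm).2, hy.1]
        rw [mem_dyadicIco_succ_left] at hx
        have hx1 : x < 2⁻¹ := by linarith [(dyadicIco_subset hkn hx).2]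
        rw [h0, h1, mul_zero, add_zero, pow_succ', mul_assoc]
        simp only [wt, if_pos hx1]
        gcongr
        exact hl h.1 hkn hx
      · obtain ⟨k, rfl⟩ := Nat.exists_eq_add_of_le (not_lt.mp hkn)
        have hkn : k < 2 ^ n := by rw [pow_succ] at hk; omega
        have h0 : ∫⁻ y, (dyadicIco (n + 1) (2 ^ n + k)).indicator
            (fun y => ENNReal.ofReal ((node e l r).wt y)) (2⁻¹ * y + 2⁻¹) ∂unitMeasure =
            ∫⁻ y, (dyadicIco n k).indicator (fun y => ENNReal.ofReal (r.wt y)) y ∂unitMeasure := by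
          refine lintegral_congr_ae ?_
          filter_upwards [ae_unitMeasure_mem] with y hy
          have h1 : ¬ (2⁻¹ * y + 2⁻¹ < 2⁻¹) := by linarith [hy.1]
          have h2 : 2 * (2⁻¹ * y + 2⁻¹) - 1 = y := by ring
          simp only [indicator_apply, mem_dyadicIco_succ_right, h2, wt, if_neg h1]
        have h1 : ∫⁻ y, (dyadicIco (n + 1) (2 ^ n + k)).indicator
            (fun y => ENNReal.ofReal ((node e l r).wt y)) (2⁻¹ * y) ∂unitMeasure = 0 := by
          rw [← lintegral_zero (μ := unitMeasure)]
          refine lintegral_congr_ae ?_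
          filter_upwards [ae_unitMeasure_mem] with y hy
          rw [indicator_of_notMem]
          rw [mem_dyadicIco_succ_right]
          intro hm
          linarith [(dyadicIco_subset hkn hm).1, hy.2]
        rw [mem_dyadicIco_succ_right] at hx
        have hx1 : ¬ x < 2⁻¹ := by linarith [(dyadicIco_subset hkn hx).1]
        rw [h0, h1, mul_zero, zero_add, pow_succ', mul_assoc]
        simp only [wt, if_neg hx1]
        gcongr
        exact hr h.2.1 hkn hx

theorem setLAverage_dyadicIco {n k : ℕ} (hk : k < 2 ^ n) (F : ℝ → ℝ≥0∞) :
    ⨍⁻ y in dyadicIco n k, F y ∂volume =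
      (∫⁻ y, (dyadicIco n k).indicator F y ∂unitMeasure) / 2⁻¹ ^ n := by
  rw [setLAverage_eq, volume_dyadicIco, unitMeasure,
    lintegral_indicator (show MeasurableSet (dyadicIco n k) from measurableSet_Ico),
    Measure.restrict_restrict (show MeasurableSet (dyadicIco n k) from measurableSet_Ico),
    inter_eq_left.mpr (dyadicIco_subset hk)]

theorem IsA1.dyadicMaximal_le {Q : ℝ} (hQ : 1 ≤ Q) {t : HaarTree} (h : t.IsA1 Q) (x : ℝ) :
    dyadicMaximal t.wt x ≤ ENNReal.ofReal Q * ENNReal.ofReal (t.wt x) := by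
  refine iSup₂_le fun I hx => ?_
  have he : ∀ y, ‖t.wt y‖ₑ = ENNReal.ofReal (t.wt y) := fun y =>
    Real.enorm_eq_ofReal (h.wt_pos y).le
  simp only [he]
  change ⨍⁻ y in dyadicIco I.1 I.2, _ ∂volume ≤ _
  rw [setLAverage_dyadicIco I.2.2, ← ENNReal.ofReal_mul (by linarith)]
  refine ENNReal.div_le_of_le_mul ?_
  rw [mul_comm]
  exact h.lintegral_indicator_le hQ I.2.2 hx

theorem IsA1.meanW_le_dyadicMaximal {Q : ℝ} {t : HaarTree} (h : t.IsA1 Q) {x : ℝ}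
    (hx : x ∈ Ico (0 : ℝ) 1) : ENNReal.ofReal t.meanW ≤ dyadicMaximal t.wt x := by
  have he : ∀ y, ‖t.wt y‖ₑ = ENNReal.ofReal (t.wt y) := fun y =>
    Real.enorm_eq_ofReal (h.wt_pos y).le
  have hs : dyadicIco 0 0 = Ico 0 1 := by simp [dyadicIco]
  have hx' : x ∈ DyadicIndex.toSet ⟨0, 0⟩ := by
    change x ∈ dyadicIco 0 0; rwa [hs]
  refine le_trans ?_ (le_iSup₂ (f := fun (I : DyadicIndex) (_ : x ∈ I.toSet) =>
    ⨍⁻ y in I.toSet, ‖t.wt y‖ₑ ∂volume) ⟨0, 0⟩ hx')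
  change _ ≤ ⨍⁻ y in dyadicIco 0 0, _ ∂volume
  simp only [he]
  rw [setLAverage_eq, volume_dyadicIco, hs, pow_zero, div_one, ← h.lintegral_wt, unitMeasure]

/-- Some value of `w` equal to the minimum is attained on a set of positive measure. -/
theorem unitMeasure_wt_eq_minW_ne_zero (t : HaarTree) :
    unitMeasure {x | t.wt x = t.minW} ≠ 0 := by
  have hms : ∀ s : HaarTree, ∀ c : ℝ, MeasurableSet {x | s.wt x = c} := fun s c =>
    measurableSet_eq_fun s.measurable_wt measurable_const
  induction t with
  | leaf f w => simp [wt, minW, unitMeasure]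
  | node e l r hl hr =>
    intro h0
    rw [← lintegral_indicator_one (hms _ _), lintegral_unitMeasure_split, add_eq_zero,
      mul_eq_zero, mul_eq_zero] at h0
    have h2 : (2⁻¹ : ℝ≥0∞) ≠ 0 := by simp
    rcases le_total l.minW r.minW with hle | hle
    · refine hl ?_
      rw [← lintegral_indicator_one (hms _ _), ← h0.1.resolve_left h2]
      refine lintegral_congr_ae ?_
      filter_upwards [ae_unitMeasure_mem] with y hy
      have h1 : 2⁻¹ * y < 2⁻¹ := by linarith [hy.2]
      have h2 : 2 * (2⁻¹ * y) = y := by ring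
      simp only [indicator_apply, mem_ofPred_eq, Pi.one_apply, wt, if_pos h1, h2, minW, min_eq_left hle]
    · refine hr ?_
      rw [← lintegral_indicator_one (hms _ _), ← h0.2.resolve_left h2]
      refine lintegral_congr_ae ?_
      filter_upwards [ae_unitMeasure_mem] with y hy
      have h1 : ¬ (2⁻¹ * y + 2⁻¹ < 2⁻¹) := by linarith [hy.1]
      have h2 : 2 * (2⁻¹ * y + 2⁻¹) - 1 = y := by ring
      simp only [indicator_apply, mem_ofPred_eq, Pi.one_apply, wt, if_neg h1, h2, minW, min_eq_right hle]

theorem IsA1.isWeight {Q : ℝ} {t : HaarTree} (h : t.IsA1 Q) : IsWeight t.wt :=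
  ⟨t.integrable_wt, ae_of_all _ h.wt_pos⟩

theorem IsA1.dyadicA1Const_le {Q : ℝ} (hQ : 1 ≤ Q) {t : HaarTree} (h : t.IsA1 Q) :
    dyadicA1Const t.wt ≤ ENNReal.ofReal Q :=
  sInf_le (ae_of_all _ (h.dyadicMaximal_le hQ))

/-- For the lower bound, the interval `[0,1)` alone already gives a maximal function of at least `Q`
on the set of positive measure where `w = 1`. -/
theorem IsA1.dyadicA1Const_eq {Q : ℝ} (hQ : 1 ≤ Q) {t : HaarTree} (h : t.IsA1 Q)
    (hW : t.meanW = Q) (hm : t.minW = 1) : dyadicA1Const t.wt = ENNReal.ofReal Q := by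
  refine le_antisymm (h.dyadicA1Const_le hQ) (le_sInf fun C hC => ?_)
  have hf : ∃ᵐ x ∂unitMeasure, t.wt x = t.minW :=
    frequently_ae_iff.mpr t.unitMeasure_wt_eq_minW_ne_zero
  have hC' : ∀ᵐ x ∂unitMeasure, dyadicMaximal t.wt x ≤ C * ENNReal.ofReal (t.wt x) := hC
  obtain ⟨x, hx, hCx, hx01⟩ := (hf.and_eventually (hC'.and ae_unitMeasure_mem)).exists
  rw [hx, hm, ENNReal.ofReal_one, mul_one] at hCx
  rw [← hW]
  exact (h.meanW_le_dyadicMaximal hx01).trans hCx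

theorem IsA1.lintegral_enorm_fn {Q : ℝ} {t : HaarTree} (h : t.IsA1 Q) :
    ∫⁻ x, ‖t.fn x‖ₑ ∂weightMeasure t.wt = ENNReal.ofReal t.cost := by
  rw [weightMeasure, lintegral_withDensity_eq_lintegral_mul _ t.measurable_wt.ennreal_ofReal
    t.measurable_fn.enorm, ← t.expect_cost 0,
    ← h.lintegral_eq_expect (fun g f w hf hw => mul_nonneg hf hw) 0]
  refine lintegral_congr fun x => ?_
  rw [Pi.mul_apply, Real.enorm_eq_ofReal (h.fn_nonneg x),
    ← ENNReal.ofReal_mul (h.wt_pos x).le, mul_comm]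

theorem IsA1.integrable_fn_weightMeasure {Q : ℝ} {t : HaarTree} (h : t.IsA1 Q) :
    Integrable t.fn (weightMeasure t.wt) :=
  ⟨t.measurable_fn.aestronglyMeasurable, by
    rw [hasFiniteIntegral_iff_enorm, h.lintegral_enorm_fn]; exact ENNReal.ofReal_lt_top⟩

/-! ### From moments to the weak norm -/

/-- Second moment lower bound for the weighted measure of a super-level set. -/
theorem IsA1.le_weightMeasure_transform {Q : ℝ} {t : HaarTree} (h : t.IsA1 Q) {α : ℝ}
    {b : ℝ} (hb : 0 ≤ b) :
    ENNReal.ofReal (2 * b * (t.moment₁ - α * t.meanW) -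
        b ^ 2 * (t.moment₂ - 2 * α * t.moment₁ + α ^ 2 * t.meanW)) ≤
      weightMeasure t.wt {x | α < |martingaleTransform t.symbol t.fn x|} := by
  classical
  have hms : MeasurableSet {x | α < t.transf x} :=
    measurableSet_lt measurable_const t.measurable_transf
  have hle : weightMeasure t.wt {x | α < t.transf x} ≤
      weightMeasure t.wt {x | α < |martingaleTransform t.symbol t.fn x|} := by
    refine measure_mono_ae ((withDensity_absolutelyContinuous _ _).ae_le ?_)
    filter_upwards [ae_unitMeasure_mem] with x hx hlt
    change α < |martingaleTransform t.symbol t.fn x|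
    rw [t.martingaleTransform_eq_transf hx]
    exact lt_of_lt_of_le hlt (le_abs_self _)
  refine le_trans ?_ hle
  have hmass : weightMeasure t.wt {x | α < t.transf x} =
      ENNReal.ofReal (t.expect (fun g _ w => if α < g then w else 0) 0) := by
    rw [← h.lintegral_eq_expect (fun g f w _ hw => by split_ifs <;> simp [hw]) 0,
      weightMeasure, withDensity_apply _ hms, ← lintegral_indicator hms]
    refine lintegral_congr fun x => ?_
    simp only [indicator_apply, mem_ofPred_eq, zero_add]
    split_ifs <;> simp
  rw [hmass]
  refine ENNReal.ofReal_le_ofReal ?_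
  -- With `s = g - α`, the quadratic `2bs - (bs)² = 1 - (bs - 1)²` is at most 1 everywhere and at
  -- most 0 for `s ≤ 0`.
  have hq := h.expect_mono (Φ := fun g _ w => (2 * b * (g - α) - b ^ 2 * (g - α) ^ 2) * w)
    (Ψ := fun g _ w => if α < g then w else 0) (fun g f w _ hw => ?_) 0
  · rw [expect_quadratic] at hq
    linarith
  · split_ifs with hg
    · exact mul_le_of_le_one_left hw (by nlinarith [sq_nonneg (b * (g - α) - 1)])
    · refine mul_nonpos_of_nonpos_of_nonneg ?_ hw
      have := mul_nonneg hb (sub_nonneg.mpr (not_lt.mp hg))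
      nlinarith [sq_nonneg (b * (g - α))]

theorem IsA1.le_weakNorm {Q : ℝ} {t : HaarTree} (h : t.IsA1 Q) (hc : 0 < t.cost) {α b κ : ℝ}
    (hα : 0 < α) (hb : 0 ≤ b)
    (hκ : κ * t.cost ≤ α * (2 * b * (t.moment₁ - α * t.meanW) -
        b ^ 2 * (t.moment₂ - 2 * α * t.moment₁ + α ^ 2 * t.meanW))) :
    ENNReal.ofReal κ ≤ weakNorm (martingaleTransform t.symbol) t.wt := by
  refine le_sInf fun C hC => ?_
  have h1 := hC t.fn h.integrable_fn_weightMeasure α hα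
  rw [h.lintegral_enorm_fn] at h1
  have h2 : ENNReal.ofReal κ * ENNReal.ofReal t.cost ≤ C * ENNReal.ofReal t.cost := by
    refine le_trans ?_ ((mul_le_mul' le_rfl (h.le_weightMeasure_transform hb)).trans h1)
    rw [← ENNReal.ofReal_mul' hc.le, ← ENNReal.ofReal_mul hα.le]
    exact ENNReal.ofReal_le_ofReal hκ
  exact (ENNReal.mul_le_mul_iff_left (ENNReal.ofReal_pos.mpr hc).ne' ENNReal.ofReal_ne_top).mp h2


/-! ### The extremal trees -/

/-- The tree of mean weight `Q` that lets `f` vanish where the weight is large. -/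
def dropTree (Q F : ℝ) : HaarTree := node false (leaf (2 * F) 1) (leaf 0 (2 * Q - 1))

/-- `j` consecutive attempts to increase the transform, each of them followed by a
(weight-rescaled) copy of `K` on its left half; `f` is dropped after the last attempt. -/
def attempts (Q F : ℝ) (K : HaarTree) : ℕ → HaarTree
  | 0 => dropTree Q F
  | j + 1 => node true (K.scaleW ((3 * Q - 1) / (2 * Q))) (node false (attempts Q F K j) (leaf 0 1))

/-- Iteration of `attempts`. -/
def cycles (N : ℕ) : ℕ → HaarTree
  | 0 => dropTree (4 ^ N) 3
  | n + 1 => attempts (4 ^ N) (2 + 4 ^ N) (cycles N n) N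

/-- The normalization shared by the trees `cycles N n`. -/
structure Normalized (Q : ℝ) (K : HaarTree) : Prop where
  isA1 : K.IsA1 Q
  meanW_eq : K.meanW = Q
  minW_eq : K.minW = 1

theorem normalized_dropTree {Q F : ℝ} (hQ : 1 ≤ Q) (hF : 0 ≤ F) :
    Normalized Q (dropTree Q F) := by
  have hm : (dropTree Q F).minW = 1 := by
    simp only [dropTree, minW]; exact min_eq_left (by linarith)
  have hW : (dropTree Q F).meanW = Q := by simp only [dropTree, meanW]; ring
  refine ⟨⟨⟨by linarith, one_pos⟩, ⟨le_rfl, by linarith⟩, ?_⟩, hW, hm⟩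
  change (dropTree Q F).meanW ≤ Q * (dropTree Q F).minW
  rw [hm, hW, mul_one]

theorem normalized_attempts {Q F : ℝ} (hQ : 1 ≤ Q) (hF : 0 ≤ F) {K : HaarTree}
    (hK : Normalized Q K) (j : ℕ) : Normalized Q (attempts Q F K j) := by
  induction j with
  | zero => exact normalized_dropTree hQ hF
  | succ j ih =>
    have hQ0 : 0 < Q := by linarith
    -- The right half has mean weight `(Q + 1) / 2`, so the left half needs `(3Q - 1) / 2` to
    -- restore the mean `Q`. As the factor is at least 1, rescaling does not lower the minimum.
    have hρ : 1 ≤ (3 * Q - 1) / (2 * Q) := by rw [le_div_iff₀ (by linarith)]; linarith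
    have hm : (attempts Q F K (j + 1)).minW = 1 := by
      simp only [attempts, minW, ih.minW_eq, min_self,
        minW_scaleW (zero_le_one.trans hρ), hK.minW_eq, mul_one]
      exact min_eq_right hρ
    have hW : (attempts Q F K (j + 1)).meanW = Q := by
      simp only [attempts, meanW, ih.meanW_eq, meanW_scaleW, hK.meanW_eq]
      field_simp; ring
    refine ⟨⟨hK.isA1.scaleW (by linarith), ⟨ih.isA1, ⟨le_rfl, one_pos⟩, ?_⟩, ?_⟩, hW, hm⟩
    · simp only [meanW, minW, ih.meanW_eq, ih.minW_eq, min_self]; linarith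
    · change (attempts Q F K (j + 1)).meanW ≤ Q * (attempts Q F K (j + 1)).minW
      rw [hm, hW, mul_one]

theorem one_le_four_pow (N : ℕ) : (1 : ℝ) ≤ 4 ^ N := one_le_pow₀ (by norm_num)

theorem normalized_cycles (N n : ℕ) : Normalized (4 ^ N) (cycles N n) := by
  induction n with
  | zero => exact normalized_dropTree (one_le_four_pow N) (by norm_num)
  | succ n ih => exact normalized_attempts (one_le_four_pow N) (by positivity) ih N

/-- The mean evolves by `F ↦ (3 + F / 2) / 2`, which fixes 2 and contracts by 4. Hence `2 + 4 ^ N`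
returns to 3 after `N` steps and cycles can be nested. -/
theorem meanF_attempts (Q : ℝ) (N : ℕ) {K : HaarTree} (hF : K.meanF = 3) (j : ℕ) :
    (attempts Q (2 + 4 ^ N) K j).meanF = 2 + 4 ^ N / 4 ^ j := by
  induction j with
  | zero => simp only [attempts, dropTree, meanF]; ring
  | succ j ih =>
    simp only [attempts, meanF, meanF_scaleW, hF, ih, pow_succ]
    field_simp; ring

theorem meanF_cycles (N n : ℕ) : (cycles N n).meanF = 3 := by
  induction n with
  | zero => simp only [cycles, dropTree, meanF]; norm_num
  | succ n ih =>
    rw [cycles, meanF_attempts _ _ ih, div_self (by positivity)]; norm_num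

theorem cost_attempts (Q F : ℝ) (K : HaarTree) (j : ℕ) :
    4 ^ j * (attempts Q F K j).cost =
      2 / 3 * ((3 * Q - 1) / (2 * Q)) * K.cost * (4 ^ j - 1) + F := by
  induction j with
  | zero => simp only [attempts, dropTree, cost]; ring
  | succ j ih =>
    simp only [attempts, cost, cost_scaleW]
    rw [pow_succ]
    linear_combination ih

theorem cost_nonneg {Q : ℝ} {t : HaarTree} (h : t.IsA1 Q) : 0 ≤ t.cost := by
  rw [← t.expect_cost 0]
  exact h.expect_nonneg (fun g f w hf hw => mul_nonneg hf hw) 0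

/-! ### Moments within one cycle -/

section Step

variable {Q : ℝ} {N : ℕ} {K : HaarTree} (hQ : 1 ≤ Q) (hK : Normalized Q K) (hF : K.meanF = 3)

include hQ hK hF

/-- The last term is the jump `4 ^ N / 4 ^ (j + 1) - 1` times half the difference `Q - 1` of the
mean weights of the two halves. -/
theorem moment₁_attempts_succ (j : ℕ) :
    (attempts Q (2 + 4 ^ N) K (j + 1)).moment₁ =
      (3 * Q - 1) / (2 * Q) * K.moment₁ / 2 + (attempts Q (2 + 4 ^ N) K j).moment₁ / 4 +
        (4 ^ N / 4 ^ (j + 1) - 1) * ((Q - 1) / 2) := by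
  have hQ0 : Q ≠ 0 := by linarith
  simp only [attempts, moment₁, meanF, meanW, meanF_scaleW, meanW_scaleW, moment₁_scaleW, hF,
    meanF_attempts Q N hF j, (normalized_attempts hQ (by positivity : (0 : ℝ) ≤ 2 + 4 ^ N) hK
      j).meanW_eq, hK.meanW_eq, coef, cond_true, cond_false, pow_succ]
  field_simp; ring

theorem moment₂_attempts_succ (j : ℕ) :
    (attempts Q (2 + 4 ^ N) K (j + 1)).moment₂ =
      (3 * Q - 1) / (2 * Q) * K.moment₂ / 2 + (attempts Q (2 + 4 ^ N) K j).moment₂ / 4 +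
        (4 ^ N / 4 ^ (j + 1) - 1) * ((3 * Q - 1) / (2 * Q) * K.moment₁ -
          (attempts Q (2 + 4 ^ N) K j).moment₁ / 2) + (4 ^ N / 4 ^ (j + 1) - 1) ^ 2 * Q := by
  have hQ0 : Q ≠ 0 := by linarith
  simp only [attempts, moment₁, moment₂, meanF, meanW, meanF_scaleW, meanW_scaleW, moment₁_scaleW,
    moment₂_scaleW, hF, meanF_attempts Q N hF j, (normalized_attempts hQ
      (by positivity : (0 : ℝ) ≤ 2 + 4 ^ N) hK j).meanW_eq, hK.meanW_eq, coef, cond_true,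
    cond_false, pow_succ]
  field_simp; ring

theorem moment₁_attempts (j : ℕ) :
    4 ^ j * (attempts Q (2 + 4 ^ N) K j).moment₁ =
      2 / 3 * ((3 * Q - 1) / (2 * Q)) * K.moment₁ * (4 ^ j - 1) +
        (j * 4 ^ N - 4 / 3 * (4 ^ j - 1)) * ((Q - 1) / 2) := by
  induction j with
  | zero => simp [attempts, dropTree, moment₁, coef]
  | succ j ih =>
    rw [moment₁_attempts_succ hQ hK hF]
    have h4 : (4 : ℝ) ^ (j + 1) * (4 ^ N / 4 ^ (j + 1)) = 4 ^ N := by field_simp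
    push_cast
    rw [pow_succ] at h4 ⊢
    linear_combination ih + (Q - 1) / 2 * h4

theorem moment₁_attempts_nonneg (hG : 0 ≤ K.moment₁) {j : ℕ} (hj : j ≤ N) :
    0 ≤ (attempts Q (2 + 4 ^ N) K j).moment₁ := by
  induction j with
  | zero => simp [attempts, dropTree, moment₁, coef]
  | succ j ih =>
    rw [moment₁_attempts_succ hQ hK hF]
    have h1 : (1 : ℝ) ≤ 4 ^ N / 4 ^ (j + 1) := by
      rw [one_le_div (by positivity)]; exact pow_le_pow_right₀ (by norm_num) hj
    have h2 : 0 ≤ (3 * Q - 1) / (2 * Q) := div_nonneg (by linarith) (by linarith)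
    have h3 := ih (by omega)
    have h4 : 0 ≤ (4 ^ N / 4 ^ (j + 1) - 1) * ((Q - 1) / 2) :=
      mul_nonneg (by linarith) (by linarith)
    positivity

/-- The cross term with the remaining attempts is negative and is discarded; the one with `K` adds
at most the same amount at each step, and the squared jumps sum to a geometric series. -/
theorem moment₂_attempts_le (hG : 0 ≤ K.moment₁) {j : ℕ} (hj : j ≤ N) :
    4 ^ j * (attempts Q (2 + 4 ^ N) K j).moment₂ ≤
      2 / 3 * ((3 * Q - 1) / (2 * Q)) * K.moment₂ * (4 ^ j - 1) +
        (3 * Q - 1) / (2 * Q) * K.moment₁ * (j * 4 ^ N) +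
        Q * (4 ^ N) ^ 2 / 3 * (1 - 1 / 4 ^ j) := by
  induction j with
  | zero => simp [attempts, dropTree, moment₂, moment₁, coef]
  | succ j ih =>
    rw [moment₂_attempts_succ hQ hK hF]
    have h0 := moment₁_attempts_nonneg hQ hK hF hG (show j ≤ N by omega)
    have ih := ih (by omega)
    have h1 : (1 : ℝ) ≤ 4 ^ N / 4 ^ (j + 1) := by
      rw [one_le_div (by positivity)]; exact pow_le_pow_right₀ (by norm_num) hj
    have h2 : 0 ≤ (3 * Q - 1) / (2 * Q) := div_nonneg (by linarith) (by linarith)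
    have hp : (0 : ℝ) < 4 ^ j := by positivity
    set ρ := (3 * Q - 1) / (2 * Q)
    set u : ℝ := 4 ^ N / 4 ^ (j + 1) with hu
    have h4 : (4 : ℝ) ^ N = 4 * 4 ^ j * u := by rw [hu, pow_succ]; field_simp
    have e1 : Q * (4 ^ N) ^ 2 / 3 * (1 - 1 / 4 ^ (j + 1)) =
        Q * (4 ^ N) ^ 2 / 3 * (1 - 1 / 4 ^ j) + 4 * 4 ^ j * u ^ 2 * Q := by
      rw [h4, pow_succ]; field_simp; ring
    have e2 : 4 ^ (j + 1) * (ρ * K.moment₂ / 2 + (attempts Q (2 + 4 ^ N) K j).moment₂ / 4 +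
        (u - 1) * (ρ * K.moment₁ - (attempts Q (2 + 4 ^ N) K j).moment₁ / 2) + (u - 1) ^ 2 * Q) =
        4 ^ j * (attempts Q (2 + 4 ^ N) K j).moment₂ + 2 * 4 ^ j * ρ * K.moment₂ +
        4 * 4 ^ j * ((u - 1) * (ρ * K.moment₁)) -
        2 * 4 ^ j * ((u - 1) * (attempts Q (2 + 4 ^ N) K j).moment₁) +
        4 * 4 ^ j * ((u - 1) ^ 2 * Q) := by rw [pow_succ]; ring
    have i1 : 4 * 4 ^ j * ((u - 1) * (ρ * K.moment₁)) ≤ ρ * K.moment₁ * 4 ^ N := by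
      have : 0 ≤ 4 * 4 ^ j * (ρ * K.moment₁) := by positivity
      rw [h4]; linarith
    have i2 : 0 ≤ 2 * 4 ^ j * ((u - 1) * (attempts Q (2 + 4 ^ N) K j).moment₁) :=
      mul_nonneg (by positivity) (mul_nonneg (by linarith) h0)
    have i3 : 4 * 4 ^ j * ((u - 1) ^ 2 * Q) ≤ 4 * 4 ^ j * u ^ 2 * Q := by
      have : (u - 1) ^ 2 ≤ u ^ 2 := pow_le_pow_left₀ (by linarith) (by linarith) 2
      rw [mul_assoc (4 * 4 ^ j)]
      exact mul_le_mul_of_nonneg_left (mul_le_mul_of_nonneg_right this (by linarith))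
        (by positivity)
    rw [e2, e1]
    push_cast
    have e3 : (4 : ℝ) ^ (j + 1) = 4 * 4 ^ j := by rw [pow_succ]; ring
    rw [e3]
    linarith

end Step

/-! ### Iteration over the cycles -/

/-- The copies of the previous tree carry a total factor below 1, and the final drop costs `(2 + Q)
/ Q ≤ 3`. -/
theorem cost_cycles_succ_le (N n : ℕ) : (cycles N (n + 1)).cost ≤ (cycles N n).cost + 3 := by
  have h := cost_attempts (4 ^ N) (2 + 4 ^ N) (cycles N n) N
  have hc := cost_nonneg (normalized_cycles N n).isA1
  have hQ := one_le_four_pow N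
  change 4 ^ N * (cycles N (n + 1)).cost = _ at h
  set Q : ℝ := 4 ^ N
  have hQ0 : 0 < Q := by linarith
  refine le_of_mul_le_mul_left (h.trans_le ?_) hQ0
  have hρ : 2 / 3 * ((3 * Q - 1) / (2 * Q)) ≤ 1 := by
    rw [← mul_div_assoc, div_le_one (by linarith)]; linarith
  have : 2 / 3 * ((3 * Q - 1) / (2 * Q)) * ((cycles N n).cost * (Q - 1)) ≤
      1 * ((cycles N n).cost * (Q - 1)) :=
    mul_le_mul_of_nonneg_right hρ (mul_nonneg hc (by linarith))
  nlinarith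

theorem cost_cycles_le (N n : ℕ) : (cycles N n).cost ≤ 3 * (n + 1) := by
  induction n with
  | zero => simp [cycles, dropTree, cost]
  | succ n ih => have := cost_cycles_succ_le N n; push_cast; linarith

theorem cost_cycles_pos (N n : ℕ) : 0 < (cycles N n).cost := by
  induction n with
  | zero => simp [cycles, dropTree, cost]
  | succ n ih =>
    have h := cost_attempts (4 ^ N) (2 + 4 ^ N) (cycles N n) N
    have hQ := one_le_four_pow N
    change 4 ^ N * (cycles N (n + 1)).cost = _ at h
    set Q : ℝ := 4 ^ N
    have hQ0 : 0 < Q := by linarith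
    refine pos_of_mul_pos_right (a := Q) ?_ hQ0.le
    rw [h]
    have : 0 ≤ (3 * Q - 1) / (2 * Q) := div_nonneg (by linarith) (by linarith)
    have : 0 ≤ Q - 1 := by linarith
    positivity

theorem moment₁_cycles_nonneg (N n : ℕ) : 0 ≤ (cycles N n).moment₁ := by
  induction n with
  | zero => simp [cycles, dropTree, moment₁, coef]
  | succ n ih =>
    exact moment₁_attempts_nonneg (one_le_four_pow N) (normalized_cycles N n) (meanF_cycles N n)
      ih le_rfl

/-- The first moment gained by one cycle. -/
def gain (N : ℕ) : ℝ := (N - 4 / 3 * (1 - 1 / 4 ^ N)) * ((4 ^ N - 1) / 2)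

/-- The factor in front is the fraction of the weighted mass that lies in copies of the previous
tree. -/
theorem moment₁_cycles_succ (N n : ℕ) : (cycles N (n + 1)).moment₁ =
    (1 - 1 / (3 * 4 ^ N)) * (1 - 1 / 4 ^ N) * (cycles N n).moment₁ + gain N := by
  have h := moment₁_attempts (N := N) (one_le_four_pow N) (normalized_cycles N n)
    (meanF_cycles N n) N
  change 4 ^ N * (cycles N (n + 1)).moment₁ = _ at h
  unfold gain
  have hQ0 : (0 : ℝ) < 4 ^ N := by positivity
  refine mul_left_cancel₀ hQ0.ne' (h.trans ?_)
  field_simp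

theorem gain_le (N : ℕ) (hN : 4 ≤ N) : gain N ≤ N * 4 ^ N / 2 := by
  have hQ := one_le_four_pow N
  have : (1 : ℝ) / 4 ^ N ≤ 1 := by rw [div_le_one (by linarith)]; exact hQ
  have hN' : (4 : ℝ) ≤ N := by exact_mod_cast hN
  have : gain N ≤ N * ((4 ^ N - 1) / 2) :=
    mul_le_mul_of_nonneg_right (by linarith) (by linarith)
  linarith

theorem le_gain (N : ℕ) (hN : 4 ≤ N) : N * 4 ^ N / 4 ≤ gain N := by
  have hQ : (4 : ℝ) ^ 4 ≤ 4 ^ N := pow_le_pow_right₀ (by norm_num) hN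
  have : (0 : ℝ) ≤ 1 / 4 ^ N := by positivity
  have hN' : (4 : ℝ) ≤ N := by exact_mod_cast hN
  -- For `N ≥ 4` one has `N - 4/3 ≥ 2N/3` and `(Q - 1) / 2 ≥ 3Q/8`.
  have : (N * (2 / 3) : ℝ) * (3 / 8 * 4 ^ N) ≤ gain N :=
    mul_le_mul (by linarith) (by linarith) (by positivity) (by linarith)
  linarith

theorem moment₁_cycles_le (N n : ℕ) (hN : 4 ≤ N) :
    (cycles N n).moment₁ ≤ n * (N * 4 ^ N / 2) := by
  induction n with
  | zero => simp [cycles, dropTree, moment₁, coef]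
  | succ n ih =>
    rw [moment₁_cycles_succ]
    have hQ := one_le_four_pow N
    have h1 : (0 : ℝ) ≤ 1 / 4 ^ N := by positivity
    have h2 : (1 : ℝ) / 4 ^ N ≤ 1 := by rw [div_le_one (by linarith)]; exact hQ
    have h3 : (0 : ℝ) ≤ 1 / (3 * 4 ^ N) := by positivity
    have h4 := mul_le_of_le_one_left (moment₁_cycles_nonneg N n)
      (mul_le_one₀ (by linarith : 1 - 1 / (3 * (4 : ℝ) ^ N) ≤ 1) (by linarith)
        (by linarith : 1 - 1 / (4 : ℝ) ^ N ≤ 1))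
    have := gain_le N hN
    push_cast; linarith

/-- A cycle keeps at least the fraction `1 - 4 / (3Q)`, so for `n ≤ Q` a bound `c * gain * n` loses
at most `4c/3` gains. The induction closes when `c + 4c/3 ≤ 1`, whence `c = 3/7`. -/
theorem le_moment₁_cycles (N n : ℕ) (hN : 4 ≤ N) (hn : (n : ℝ) ≤ 4 ^ N) :
    3 / 7 * gain N * n ≤ (cycles N n).moment₁ := by
  induction n with
  | zero => simp [cycles, dropTree, moment₁, coef]
  | succ n ih =>
    push_cast at hn ⊢
    have ih := ih (by linarith)
    rw [moment₁_cycles_succ]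
    have hQ := one_le_four_pow N
    have hg : 0 ≤ gain N := le_trans (by positivity) (le_gain N hN)
    have hθ : 1 - 4 / 3 / 4 ^ N ≤ (1 - 1 / (3 * (4 : ℝ) ^ N)) * (1 - 1 / 4 ^ N) := by
      have : (0 : ℝ) ≤ 1 / 4 ^ N * (1 / 4 ^ N) := by positivity
      have e1 : (1 : ℝ) / (3 * 4 ^ N) = 1 / 4 ^ N / 3 := by field_simp
      have e2 : (4 : ℝ) / 3 / 4 ^ N = 4 / 3 * (1 / 4 ^ N) := by field_simp
      rw [e1, e2]; nlinarith
    have h0 : 0 ≤ 1 - 4 / 3 / (4 : ℝ) ^ N := by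
      rw [sub_nonneg, div_le_one (by positivity)]
      have : (4 : ℝ) ^ 4 ≤ 4 ^ N := pow_le_pow_right₀ (by norm_num) hN
      linarith
    have h1 := (mul_le_mul_of_nonneg_left ih h0).trans
      (mul_le_mul_of_nonneg_right hθ (moment₁_cycles_nonneg N n))
    have h2 : (4 / 3 / (4 : ℝ) ^ N) * n ≤ 4 / 3 := by
      rw [div_mul_eq_mul_div, div_le_iff₀ (by positivity)]; linarith
    have h3 := mul_le_mul_of_nonneg_left h2 (by positivity : 0 ≤ 3 / 7 * gain N)
    linarith

theorem moment₂_nonneg_cycles (N n : ℕ) : 0 ≤ (cycles N n).moment₂ := by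
  have h := expect_quadratic (cycles N n) 0 (-1) 0 0
  have h' := (normalized_cycles N n).isA1.expect_nonneg
    (Φ := fun g _ w => (0 * (g - 0) - -1 * (g - 0) ^ 2) * w)
    (fun g f w _ hw => mul_nonneg (by nlinarith [sq_nonneg g]) hw) 0
  rw [h] at h'
  linarith

/-- A cycle adds at most `(3/2) N G + Q² / 3`, where the first moment `G` is at most `N Q² / 2`
because `n ≤ Q`. -/
theorem moment₂_cycles_le (N n : ℕ) (hN : 4 ≤ N) (hn : (n : ℝ) ≤ 4 ^ N) :
    (cycles N n).moment₂ ≤ n * (2 * N ^ 2 * (4 ^ N) ^ 2) := by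
  induction n with
  | zero => simp [cycles, dropTree, moment₂, moment₁, coef]
  | succ n ih =>
    push_cast at hn ⊢
    have ih := ih (by linarith)
    have h := moment₂_attempts_le (N := N) (one_le_four_pow N) (normalized_cycles N n)
      (meanF_cycles N n) (moment₁_cycles_nonneg N n) (le_refl N)
    change 4 ^ N * (cycles N (n + 1)).moment₂ ≤ _ at h
    have hG := moment₁_cycles_le N n hN
    have hG0 := moment₁_cycles_nonneg N n
    have hM0 := moment₂_nonneg_cycles N n
    have hN' : (4 : ℝ) ≤ N := by exact_mod_cast hN
    have hQ := one_le_four_pow N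
    set Q : ℝ := 4 ^ N
    have hQ0 : 0 < Q := by linarith
    have hρ : (3 * Q - 1) / (2 * Q) ≤ 3 / 2 := by rw [div_le_iff₀ (by linarith)]; linarith
    have hρ0 : 0 ≤ (3 * Q - 1) / (2 * Q) := div_nonneg (by linarith) (by linarith)
    have h1 : (3 * Q - 1) / (2 * Q) * ((cycles N n).moment₂ * (Q - 1)) ≤
        3 / 2 * ((cycles N n).moment₂ * Q) :=
      mul_le_mul hρ (mul_le_mul_of_nonneg_left (by linarith) hM0)
        (mul_nonneg hM0 (by linarith)) (by norm_num)
    have hG' : (cycles N n).moment₁ ≤ Q * (N * Q / 2) :=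
      hG.trans (mul_le_mul_of_nonneg_right (by linarith) (by positivity))
    have h2 : (3 * Q - 1) / (2 * Q) * ((cycles N n).moment₁ * (N * Q)) ≤
        3 / 2 * (Q * (N * Q / 2) * (N * Q)) :=
      mul_le_mul hρ (mul_le_mul_of_nonneg_right hG' (by positivity)) (by positivity) (by norm_num)
    have h3 : Q * Q ^ 2 / 3 * (1 - 1 / Q) ≤ Q * Q ^ 2 / 3 :=
      mul_le_of_le_one_right (by positivity) (by linarith [show 0 ≤ 1 / Q by positivity])
    have h4 : Q ^ 3 * 1 ≤ Q ^ 3 * (N : ℝ) ^ 2 :=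
      mul_le_mul_of_nonneg_left (one_le_pow₀ (by linarith)) (by positivity)
    refine le_of_mul_le_mul_left (h.trans ?_) hQ0
    have h5 := mul_le_mul_of_nonneg_left ih hQ0.le
    have h6 : 0 < Q ^ 3 := by positivity
    generalize (3 * Q - 1) / (2 * Q) = ρ at *
    generalize 1 / Q = τ at *
    linarith

/-- A lower bound of order `Q log Q` for `Q = 4 ^ N`. -/
theorem le_weakNorm_cycles (N : ℕ) (hN : 4 ≤ N) :
    ENNReal.ofReal (N * 4 ^ N / 96000) ≤
      weakNorm (martingaleTransform (cycles N (4 ^ N)).symbol) (cycles N (4 ^ N)).wt := by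
  have hn : (((4 ^ N : ℕ) : ℕ) : ℝ) = 4 ^ N := by push_cast; rfl
  have hK := normalized_cycles N (4 ^ N)
  have hc := cost_cycles_le N (4 ^ N)
  have h1 := le_moment₁_cycles N (4 ^ N) hN hn.le
  have h2 := moment₂_cycles_le N (4 ^ N) hN hn.le
  have hg := le_gain N hN
  rw [hn] at hc h1 h2
  have hN' : (4 : ℝ) ≤ N := by exact_mod_cast hN
  have hQ4 : (4 : ℝ) ^ 4 ≤ 4 ^ N := pow_le_pow_right₀ (by norm_num) hN
  -- With `P = N Q`, the first moment is at least `P Q / 10`, and `α` is half the resulting mean `P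
  -- / 10`. The value of `b` maximizes `2bA - b²B` for the bounds `A = P Q / 20` and `B = 3 P² Q` on
  -- the moments about `α`.
  refine hK.isA1.le_weakNorm (cost_cycles_pos N _) (α := N * 4 ^ N / 20)
    (b := 1 / (60 * (N * 4 ^ N))) (by positivity) (by positivity) ?_
  rw [hK.meanW_eq]
  set Q : ℝ := 4 ^ N
  set G := (cycles N (4 ^ N)).moment₁
  set M := (cycles N (4 ^ N)).moment₂
  have hQ0 : 0 < Q := by linarith
  have hP : 0 < N * Q := by positivity
  set P := N * Q
  have hG : P * Q / 10 ≤ G := by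
    have := mul_le_mul_of_nonneg_right hg hQ0.le
    have : 0 < P * Q := by positivity
    linarith
  have hM : M ≤ 2 * P ^ 2 * Q := by simp only [P]; linarith
  have e1 : 2 * (1 / (60 * P)) * (P * Q / 20) ≤ 2 * (1 / (60 * P)) * (G - P / 20 * Q) :=
    mul_le_mul_of_nonneg_left (by linarith) (by positivity)
  have e2 : (1 / (60 * P)) ^ 2 * (M - 2 * (P / 20) * G + (P / 20) ^ 2 * Q) ≤
      (1 / (60 * P)) ^ 2 * (3 * P ^ 2 * Q) := by
    refine mul_le_mul_of_nonneg_left ?_ (by positivity)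
    have : 0 ≤ P * G := mul_nonneg hP.le (le_trans (by positivity) hG)
    have : 0 < P ^ 2 * Q := by positivity
    linarith
  have e3 : 2 * (1 / (60 * P)) * (P * Q / 20) = Q / 600 := by field_simp; norm_num
  have e4 : (1 / (60 * P)) ^ 2 * (3 * P ^ 2 * Q) = Q / 1200 := by field_simp; norm_num
  have e5 : Q / 1200 ≤ 2 * (1 / (60 * P)) * (G - P / 20 * Q) -
      (1 / (60 * P)) ^ 2 * (M - 2 * (P / 20) * G + (P / 20) ^ 2 * Q) := by linarith
  -- The cost is at most `3 (Q + 1) ≤ 4Q`, and `96000 = 20 * 1200 * 4`.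
  calc P / 96000 * (cycles N (4 ^ N)).cost ≤ P / 96000 * (4 * Q) :=
        mul_le_mul_of_nonneg_left (by linarith) (by positivity)
    _ = P / 20 * (Q / 1200) := by ring
    _ ≤ _ := mul_le_mul_of_nonneg_left e5 (by positivity)

end HaarTree
end

/-! ### Conclusion -/

open HaarTree in
theorem theorem3p2 :
    ∃ c : ℝ, 0 < c ∧
      ∃ (w : ℕ → ℝ → ℝ) (ε : ℕ → DyadicIndex →₀ ℝ),
        (∀ n, IsDyadicA1 (w n)) ∧
        (∀ n I, ε n I = 0 ∨ ε n I = -1) ∧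
        Tendsto (fun n => (dyadicA1Const (w n)).toReal) atTop atTop ∧
        ∀ n, ENNReal.ofReal
            (c * (dyadicA1Const (w n)).toReal * Real.log (dyadicA1Const (w n)).toReal)
          ≤ weakNorm (martingaleTransform (ε n)) (w n) := by
  have hA : ∀ n : ℕ, dyadicA1Const (cycles (n + 4) (4 ^ (n + 4))).wt =
      ENNReal.ofReal (4 ^ (n + 4)) := fun n =>
    have hK := normalized_cycles (n + 4) (4 ^ (n + 4))
    hK.isA1.dyadicA1Const_eq (one_le_four_pow _) hK.meanW_eq hK.minW_eq
  have hA' : ∀ n : ℕ, (dyadicA1Const (cycles (n + 4) (4 ^ (n + 4))).wt).toReal =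
      4 ^ (n + 4) := fun n => by rw [hA, ENNReal.toReal_ofReal (by positivity)]
  -- The shift by 4 ensures `N ≥ 4`, and the extra factor 2 over 96000 comes from `log Q = N log 4 ≤
  -- 2N`.
  refine ⟨1 / 192000, by norm_num, fun n => (cycles (n + 4) (4 ^ (n + 4))).wt,
    fun n => (cycles (n + 4) (4 ^ (n + 4))).symbol, fun n => ⟨?_, ?_⟩, fun n I => ?_, ?_,
    fun n => ?_⟩
  · exact (normalized_cycles (n + 4) (4 ^ (n + 4))).isA1.isWeight
  · rw [hA]; exact ENNReal.ofReal_lt_top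
  · exact symbolAt_eq_zero_or _ _ _
  · simp only [hA']
    exact (tendsto_add_atTop_iff_nat 4).mpr
      (tendsto_pow_atTop_atTop_of_one_lt (by norm_num : (1 : ℝ) < 4))
  · refine le_trans (ENNReal.ofReal_le_ofReal ?_) (le_weakNorm_cycles (n + 4) (by omega))
    rw [hA', Real.log_pow]
    have h4 : Real.log 4 ≤ 2 := by
      have : (4 : ℝ) = 2 ^ 2 := by norm_num
      rw [this, Real.log_pow]; have := Real.log_two_lt_d9; push_cast; linarith
    have hN : (0 : ℝ) ≤ ((n + 4 : ℕ) : ℝ) := by positivity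
    calc 1 / 192000 * (4 : ℝ) ^ (n + 4) * (((n + 4 : ℕ) : ℝ) * Real.log 4)
        ≤ 1 / 192000 * (4 : ℝ) ^ (n + 4) * (((n + 4 : ℕ) : ℝ) * 2) := by gcongr
      _ = _ := by ring
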